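/- For natural numbers $N,F$, let $\textsc{dist-item}_{N,F}$ be the problem of outputting, for a turnstile stream $\langle(a_i,\Delta_i)\rangle_{i\le m}$ with $a_i\in[N]$, $\Delta_i\in\mathbb Z$ whose frequencies $\mathrm{freq}(j)=\sum_{i:a_i=j}\Delta_i$ satisfy $\max_j|\mathrm{freq}(j)|\le F$ at the end of the stream, the number $|\{j\in[N]:\mathrm{freq}(j)\neq 0\}|$. A classical streaming algorithm is a randomized one-pass algorithm; it solves the problem if its error probability is at most $1/3$ on every such stream; its space is the number of bits it stores, and the streaming complexity $\mathcal S$ of the problem is the least space of an algorithm that solves it. In an annotated streaming scheme a randomized one-pass Verifier, after the stream, also reads a proof sent by a Prover (who knows the stream but not Verifier's random string) and outputs a number or rejects; the scheme solves the problem if on every such stream the honest proof leads to the correct answer with probability at least $2/3$, and every proof leads to a wrong answer (neither the correct one nor rejection) with probability at most $1/3$. Its hcost is the maximal length of the honest proof in bits, its vcost the number of bits of Verifier's space, its total cost the sum. For a fixed family of bounds $F=F(N)$, a family of schemes (one for each $N$) is non-trivial if its vcost is of smaller order than $\mathcal S$ up to polylogarithmic factors, i.e. $\mathrm{vcost}\cdot(\log_2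 N)^k=o(\mathcal S)$ as $N\to\infty$ for every constant $k$. (1) For all $N,F\ge 2$, $\textsc{dist-item}_{N,F}$ is solved by a classical streaming algorithm in $O\big(N(\log\log F+\log N)\big)$ bits of space, including the storage of the random bits it uses. (2) Every scheme for $\textsc{dist-item}_{N,F}$, $F\ge 2$, with hcost at most $h$ and vcost at most $v$ satisfies $(h+\log F)\cdot v=\Omega(N\log F)$, with an absolute constant. (3) Let $F=\exp(N^{\mathrm{polylog}(N)})$; precisely, for any constant $c\in\{0,1,2,\dots\}$ let $F=2^{\lceil N^{(\log_2 N)^c}\rceil}$. Then $\textsc{dist-item}_{N,F}$ can be solved in $\tilde O(N)$ space in classical streaming (i.e. $O(N(\log N)^k)$ for some constant $k$ depending only on $c$), but every non-trivial annotated streaming scheme for the problem has total cost $\Omega\big(N^{(\log_2 N)^c}\big)$. -/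

import Mathlib

open Filter Asymptotics

namespace DistItem

/-! ### Turnstile streams and the distinct items problem -/

/-- A turnstile stream over the universe `[N]` (here `Fin N`): a finite sequence of updates
`(a, Δ)` with `a` an element and `Δ` an arbitrary integer. -/
abbrev TStream (N : ℕ) : Type := List (Fin N × ℤ)

/-- The frequency of `j`: the sum of all `Δ` over the updates `(a, Δ)` with `a = j`. -/
def freq {N : ℕ} (σ : TStream N) (j : Fin N) : ℤ :=
  ((σ.filter fun u => u.1 = j).map Prod.snd).sum

/-- The promise: at the end of the stream all frequencies are at most `F` in absolute value. -/
def Promise {N : ℕ} (F : ℕ) (σ : TStream N) : Prop :=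
  ∀ j : Fin N, |freq σ j| ≤ (F : ℤ)

/-- The number of elements with non-zero frequency. -/
def distinctItems {N : ℕ} (σ : TStream N) : ℕ :=
  (Finset.univ.filter fun j : Fin N => freq σ j ≠ 0).card

/-! ### Randomized streaming algorithms -/

/-- The contents of a memory of `s` bits. -/
abbrev Mem (s : ℕ) : Type := Fin s → Bool

/-- Random strings of `r` bits. -/
abbrev Coins (r : ℕ) : Type := Fin r → Bool

/-- The probability of an event over a uniformly random string of `r` bits. -/
noncomputable def coinProb {r : ℕ} (E : Coins r → Prop) : ℝ :=
  ({ρ : Coins r | E ρ}.ncard : ℝ) / 2 ^ r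

/-- A one-pass streaming procedure over `[N]` that keeps a summary of `s` bits and uses a random
string `ρ`. The string itself is not charged to the space. -/
structure StreamProc (N s : ℕ) where
  /-- number of random bits -/
  r : ℕ
  /-- initial memory contents -/
  init : Coins r → Mem s
  /-- processing of one update -/
  update : Coins r → Mem s → Fin N × ℤ → Mem s

/-- The summary of the stream `σ` on the random string `ρ`. -/
def StreamProc.summary {N s : ℕ} (A : StreamProc N s) (ρ : Coins A.r) (σ : TStream N) : Mem s :=
  σ.foldl (A.update ρ) (A.init ρ)

/-- A classical streaming algorithm using `s` bits of space: a streaming procedure with an output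
computed from the final summary. -/
structure ClassicalAlg (N s : ℕ) extends StreamProc N s where
  /-- the output -/
  out : Coins r → Mem s → ℕ

/-- The algorithm solves distinct items with frequency bound `F`, with error at most `1/3`. -/
def ClassicalAlg.Solves {N s : ℕ} (A : ClassicalAlg N s) (F : ℕ) : Prop :=
  ∀ σ : TStream N, Promise F σ →
    coinProb (fun ρ => A.out ρ (A.summary ρ σ) ≠ distinctItems σ) ≤ 1 / 3

/-- The algorithm consults its random string only to set up the initial memory. Whatever it needs
of the string later on is then stored in, and charged to, its `s` bits of space. -/
def ClassicalAlg.StoresCoins {N s : ℕ} (A : ClassicalAlg N s) : Prop :=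
  ∀ ρ ρ' : Coins A.r, A.update ρ = A.update ρ' ∧ A.out ρ = A.out ρ'

/-- The classical streaming complexity of distinct items over `[N]` with frequency bound `F`: the
least space of a classical streaming algorithm that solves it. -/
noncomputable def streamingComplexity (N F : ℕ) : ℕ :=
  sInf {s : ℕ | ∃ A : ClassicalAlg N s, A.Solves F}

/-! ### Annotated streaming -/

/-- An annotated streaming scheme whose verifier uses `v` bits of space. The verifier summarizes
the input stream; then it reads the proof, bit by bit, in the same memory, and outputs a number or
rejects (`none`). The prover's proof depends on the whole stream but not on the random string. -/
structure Scheme (N v : ℕ) extends StreamProc N v where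
  /-- the honest prover's proof -/
  help : TStream N → List Bool
  /-- processing of one bit of the proof -/
  read : Coins r → Mem v → Bool → Mem v
  /-- the output; `none` stands for rejection of the proof -/
  out : Coins r → Mem v → Option ℕ

/-- The verifier's output on the stream `σ`, proof `π` and random string `ρ`. -/
def Scheme.output {N v : ℕ} (P : Scheme N v) (ρ : Coins P.r) (σ : TStream N) (π : List Bool) :
    Option ℕ :=
  P.out ρ (π.foldl (P.read ρ) (P.summary ρ σ))

/-- The scheme solves distinct items with frequency bound `F`: completeness error and soundness
error are at most `1/3`. -/
def Scheme.Solves {N v : ℕ} (P : Scheme N v) (F : ℕ) : Prop :=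
  (∀ σ : TStream N, Promise F σ →
    coinProb (fun ρ => P.output ρ σ (P.help σ) ≠ some (distinctItems σ)) ≤ 1 / 3) ∧
  (∀ σ : TStream N, Promise F σ → ∀ π : List Bool,
    coinProb (fun ρ => P.output ρ σ π ≠ some (distinctItems σ) ∧ P.output ρ σ π ≠ none) ≤ 1 / 3)

/-- There is a scheme for distinct items over `[N]` with frequency bound `F` whose help cost (the
maximal length of the honest proof) is at most `h` and whose verification cost is at most `v`. -/
def HasScheme (N F h v : ℕ) : Prop :=
  ∃ P : Scheme N v, P.Solves F ∧ ∀ σ : TStream N, Promise F σ → (P.help σ).length ≤ h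

/-- Non-triviality of a family of schemes with verification costs `v N` for distinct items over
`[N]` with frequency bounds `F N`: the verification cost is of smaller order than the classical
streaming complexity, polylogarithmic factors being ignored. -/
def Nontrivial (F v : ℕ → ℕ) : Prop :=
  ∀ k : ℕ, (fun N : ℕ => (v N : ℝ) * Real.logb 2 N ^ k) =o[atTop]
    fun N : ℕ => (streamingComplexity N (F N) : ℝ)

/-! ### The frequency bound -/

/-- `N ^ polylog N`, with the polylogarithm `(log₂ N) ^ c`. -/
noncomputable def powPolylog (c N : ℕ) : ℝ := (N : ℝ) ^ (Real.logb 2 N ^ c)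

/-- `exp (N ^ polylog N)` as a natural number: `2` to the power `N ^ ((log₂ N) ^ c)`, the exponent
rounded up. -/
noncomputable def freqBound (c N : ℕ) : ℕ := 2 ^ ⌈powPolylog c N⌉₊

end DistItem

namespace DistItem

/-! ### Frequencies and probabilities -/

/-! Upper bound: keep every frequency modulo one random prime. A nonzero integer of size at most `F`
has at most `log₂ F` prime divisors, so by a union bound over the `N` elements a prime drawn from at
least `3 N log₂ F` candidates rarely kills a nonzero frequency. Chebyshev's estimate supplies that
many primes of `O(log N + log log F)` bits (`two_pow_le_primeCounting`, `residueAlg_solves`).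

Lower bound: Verifier's memory becomes a random access code. Encode a word `x` over an alphabet of
size `F` as a stream with frequencies `x j + 1`; taking `y + 1` away from `j` lowers the count
exactly when `x j = y`. The decoder plays Prover: it tries every letter and every short proof. The
union bound over these `F * 2 ^ (h + 1)` pairs requires a majority over `O(h + log F)` copies of
Verifier (`card_majority_le`, `Scheme.card_decode_ne_le`), and a code for `N` such letters needs
`Ω(N log F)` bits (`mul_logb_le_of_code`).

Separation: classical space is `N` times a polylogarithm, so non-triviality forces `v = o(N)`, and
then the tradeoff forces `h ≥ log₂ F`. -/

theorem freq_append {N : ℕ} (σ τ : TStream N) (j : Fin N) :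
    freq (σ ++ τ) j = freq σ j + freq τ j := by
  simp [freq]

theorem freq_singleton {N : ℕ} (a : Fin N) (d : ℤ) (j : Fin N) :
    freq [(a, d)] j = if a = j then d else 0 := by
  by_cases h : a = j <;> simp [freq, h]

theorem coinProb_eq {r : ℕ} (E : Coins r → Prop) [DecidablePred E] :
    coinProb E = ((Finset.univ.filter E).card : ℝ) / 2 ^ r := by
  rw [coinProb, ← Set.ncard_coe_finset]
  simp

/-! ### Many small primes -/

/-- Chebyshev's argument: `lcm(1, …, n)` is at least `2 ^ n / (n + 1)`, yet it is a product of
`π(n)` prime powers, each at most `n`. -/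
theorem two_pow_le_primeCounting (r : ℕ) : 2 ^ r ≤ Nat.primeCounting (2 ^ (2 * r + 3)) := by
  set b := 2 * r + 3 with hb
  set q := Nat.primeCounting (2 ^ b) with hq
  have h1 := Chebyshev.two_pow_le_mul_lcmUpto (2 ^ b)
  have h2 : Nat.lcmUpto (2 ^ b) ≤ (2 ^ b) ^ q := by
    rw [Nat.lcmUpto_eq_prod_pow_log, hq, ← Nat.primesLE_card_eq_primeCounting]
    exact Finset.prod_le_pow_card _ _ _ fun p _ => Nat.pow_log_le_self p (by positivity)
  have h3 : 2 ^ b + 1 ≤ 2 ^ (b + 1) := by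
    have := Nat.one_le_two_pow (n := b)
    have := pow_succ 2 b
    omega
  have h4 : 2 ^ (2 ^ b) ≤ 2 ^ (b + 1 + b * q) := by
    calc 2 ^ (2 ^ b) ≤ (2 ^ b + 1) * Nat.lcmUpto (2 ^ b) := h1
      _ ≤ 2 ^ (b + 1) * (2 ^ b) ^ q := Nat.mul_le_mul h3 h2
      _ = 2 ^ (b + 1 + b * q) := by rw [← pow_mul, ← pow_add]
  have h5 : 2 ^ b ≤ b + 1 + b * q := (Nat.pow_le_pow_iff_right (by norm_num)).1 h4
  -- If `q < 2 ^ r`, the right side of `h5` is at most `(b + 1) * 2 ^ r` with `b + 1 = 2 * (r + 2) ≤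
  -- 2 ^ (r + 2)`, short of `2 ^ (2 * r + 3)`.
  by_contra! hlt
  have h6 : r + 2 ≤ 2 ^ (r + 1) := by have := (r + 1).lt_two_pow_self; omega
  have h7 : 2 ^ b = 4 * 2 ^ (r + 1) * 2 ^ r := by rw [hb]; ring
  have h8 : b + 1 + b * q ≤ (b + 1) * 2 ^ r := by nlinarith
  have h9 : b + 1 ≤ 2 * 2 ^ (r + 1) := by omega
  have h10 : 0 < 2 ^ r := by positivity
  nlinarith

theorem exists_injective_primes (r : ℕ) : ∃ P : Coins r → ℕ, Function.Injective P ∧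
    ∀ ρ, (P ρ).Prime ∧ P ρ ≤ 2 ^ (2 * r + 3) := by
  have hc : Fintype.card (Coins r) ≤ Fintype.card (Nat.primesLE (2 ^ (2 * r + 3))) := by
    rw [Fintype.card_coe, Nat.primesLE_card_eq_primeCounting]
    simpa using two_pow_le_primeCounting r
  obtain ⟨e⟩ := Function.Embedding.nonempty_of_card_le hc
  refine ⟨fun ρ => (e ρ : ℕ), fun a b h => e.injective (Subtype.ext h), fun ρ => ?_⟩
  have := Nat.mem_primesLE.1 (e ρ).2
  exact ⟨this.2, this.1⟩

theorem card_primeFactors_le_log {n : ℕ} (hn : n ≠ 0) : n.primeFactors.card ≤ Nat.log 2 n := by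
  refine Nat.le_log_of_pow_le (by norm_num) ?_
  calc 2 ^ n.primeFactors.card ≤ ∏ p ∈ n.primeFactors, p :=
        Finset.pow_card_le_prod _ _ _ fun p hp => (Nat.prime_of_mem_primeFactors hp).two_le
    _ ≤ n := Nat.le_of_dvd (Nat.pos_of_ne_zero hn) (Nat.prod_primeFactors_dvd n)

/-! ### The residue algorithm -/

/-- The state of the residue algorithm: a modulus and a residue for every element. -/
abbrev ResState (N M : ℕ) : Type := Fin M × (Fin N → Fin M)

/-- The state of the residue algorithm with modulus `p` for the frequencies `f`. -/
def resState {N : ℕ} (M : ℕ) [NeZero M] (p : ℕ) (f : Fin N → ℤ) : ResState N M :=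
  (Fin.ofNat M p, fun j => Fin.ofNat M (f j % p).toNat)

/-- The residue algorithm's processing of an update. -/
def resUpdate {N M : ℕ} [NeZero M] (x : ResState N M) (u : Fin N × ℤ) : ResState N M :=
  (x.1, fun j =>
    if u.1 = j then Fin.ofNat M (((x.2 j : ℤ) + u.2) % ((x.1 : ℕ) : ℤ)).toNat else x.2 j)

theorem coe_ofNat_emod {M p : ℕ} [NeZero M] (hp : 0 < p) (hpM : p < M) (z : ℤ) :
    ((Fin.ofNat M (z % p).toNat : ℕ) : ℤ) = z % p := by
  have h0 : 0 ≤ z % p := Int.emod_nonneg _ (by omega)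
  have h1 : z % p < p := Int.emod_lt_of_pos _ (by omega)
  rw [Fin.val_ofNat, Nat.mod_eq_of_lt (by omega)]
  omega

theorem resUpdate_resState {N M p : ℕ} [NeZero M] (hp : 0 < p) (hpM : p < M) (f : Fin N → ℤ)
    (u : Fin N × ℤ) :
    resUpdate (resState M p f) u = resState M p fun j => f j + if u.1 = j then u.2 else 0 := by
  refine Prod.ext rfl (funext fun j => ?_)
  by_cases h : u.1 = j
  · simp only [resUpdate, resState, h, if_true]
    rw [coe_ofNat_emod hp hpM, Fin.val_ofNat, Nat.mod_eq_of_lt hpM, Int.emod_add_emod]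
  · simp [resUpdate, resState, h]

/-- The residue algorithm: it draws a random modulus `P ρ` and maintains all frequencies modulo
`P ρ`, in a memory that represents states by means of `e`. -/
def residueAlg {N M s r : ℕ} [NeZero M] (e : ResState N M ≃ Mem s) (P : Coins r → ℕ) :
    ClassicalAlg N s where
  r := r
  init ρ := e (resState M (P ρ) 0)
  update _ m u := e (resUpdate (e.symm m) u)
  out _ m := (Finset.univ.filter fun j => (((e.symm m).2 j : Fin M) : ℕ) ≠ 0).card

theorem residueAlg_summary {N M s r : ℕ} [NeZero M] (e : ResState N M ≃ Mem s) (P : Coins r → ℕ)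
    (ρ : Coins r) (hp : 0 < P ρ) (hpM : P ρ < M) (σ : TStream N) :
    (residueAlg e P).summary ρ σ = e (resState M (P ρ) (freq σ)) := by
  induction σ using List.reverseRecOn with
  | nil => rfl
  | append_singleton σ u ih =>
    have hstep : (residueAlg e P).summary ρ (σ ++ [u])
        = e (resUpdate (e.symm ((residueAlg e P).summary ρ σ)) u) := by
      simp [StreamProc.summary, residueAlg]
    rw [hstep, ih, Equiv.symm_apply_apply, resUpdate_resState hp hpM]
    congr 2
    funext j
    rw [freq_append, freq_singleton]

theorem residueAlg_out_eq {N M s r : ℕ} [NeZero M] (e : ResState N M ≃ Mem s) (P : Coins r → ℕ)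
    (ρ : Coins r) (hp : 0 < P ρ) (hpM : P ρ < M) (σ : TStream N)
    (h : ∀ j, freq σ j ≠ 0 → ¬ (P ρ : ℤ) ∣ freq σ j) :
    (residueAlg e P).out ρ ((residueAlg e P).summary ρ σ) = distinctItems σ := by
  rw [residueAlg_summary e P ρ hp hpM]
  change (Finset.univ.filter fun j => (((e.symm (e _)).2 j : Fin M) : ℕ) ≠ 0).card = _
  rw [Equiv.symm_apply_apply, distinctItems]
  congr 1
  refine Finset.filter_congr fun j _ => not_congr ?_
  have := coe_ofNat_emod hp hpM (freq σ j)
  simp only [resState]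
  rw [← Int.natCast_eq_zero, this]
  constructor
  · intro h0
    by_contra hne
    exact h j hne (Int.dvd_of_emod_eq_zero h0)
  · intro h0
    simp [h0]

/-- Distinct seeds give distinct primes, so the bad seeds inject into the prime factors of `z`. -/
theorem card_dvd_le {r F : ℕ} {P : Coins r → ℕ} (hP : Function.Injective P)
    (hprime : ∀ ρ, (P ρ).Prime) {z : ℤ} (hz : z ≠ 0) (hzF : |z| ≤ F) :
    (Finset.univ.filter fun ρ => (P ρ : ℤ) ∣ z).card ≤ Nat.log 2 F := by
  calc (Finset.univ.filter fun ρ => (P ρ : ℤ) ∣ z).card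
      ≤ z.natAbs.primeFactors.card := by
        refine Finset.card_le_card_of_injOn P (fun ρ hρ => ?_) hP.injOn
        have hd : (P ρ : ℤ) ∣ z := by simpa using hρ
        simp only [Finset.mem_coe, Nat.mem_primeFactors]
        exact ⟨hprime ρ, Int.natCast_dvd.1 hd, by omega⟩
    _ ≤ Nat.log 2 z.natAbs := card_primeFactors_le_log (by omega)
    _ ≤ Nat.log 2 F := Nat.log_mono_right (by rw [Int.abs_eq_natAbs] at hzF; exact_mod_cast hzF)

theorem residueAlg_solves {N M s r F : ℕ} [NeZero M] (e : ResState N M ≃ Mem s)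
    {P : Coins r → ℕ} (hP : Function.Injective P) (hprime : ∀ ρ, (P ρ).Prime)
    (hM : ∀ ρ, P ρ < M) (hr : 3 * (N * Nat.log 2 F) ≤ 2 ^ r) : (residueAlg e P).Solves F := by
  classical
  intro σ hσ
  let E : Coins r → Prop := fun ρ =>
    (residueAlg e P).out ρ ((residueAlg e P).summary ρ σ) ≠ distinctItems σ
  suffices hE : coinProb E ≤ 1 / 3 from hE
  rw [coinProb_eq]
  have hcard : (Finset.univ.filter E).card ≤ N * Nat.log 2 F := by
    calc _ ≤ ((Finset.univ.filter fun j => freq σ j ≠ 0).biUnion fun j =>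
          Finset.univ.filter fun ρ => (P ρ : ℤ) ∣ freq σ j).card := by
          refine Finset.card_le_card fun ρ hρ => ?_
          have hne := (Finset.mem_filter.1 hρ).2
          by_contra hno
          refine hne (residueAlg_out_eq e P ρ (hprime ρ).pos (hM ρ) σ fun j hj hd => hno ?_)
          simp only [Finset.mem_biUnion, Finset.mem_filter, Finset.mem_univ, true_and]
          exact ⟨j, hj, hd⟩
      _ ≤ (Finset.univ.filter fun j => freq σ j ≠ 0).card * Nat.log 2 F :=
          Finset.card_biUnion_le_card_mul _ _ _ fun j hj =>
            card_dvd_le hP hprime (Finset.mem_filter.1 hj).2 (hσ j)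
      _ ≤ N * Nat.log 2 F :=
          Nat.mul_le_mul_right _ ((Finset.card_le_univ _).trans (by simp))
  rw [div_le_div_iff₀ (by positivity) (by norm_num), one_mul]
  exact_mod_cast (Nat.mul_le_mul_right 3 hcard).trans (by omega)

theorem exists_classicalAlg (N F r : ℕ) (hr : 3 * (N * Nat.log 2 F) ≤ 2 ^ r) :
    ∃ A : ClassicalAlg N ((N + 1) * (2 * r + 4)), A.Solves F ∧ A.StoresCoins := by
  obtain ⟨P, hP, h⟩ := exists_injective_primes r
  -- One modulus and `N` residues, each of `2 * r + 4` bits: one bit more than the bound `2 ^ (2 * r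
  -- + 3)` on the primes, so that they lie strictly below `M`.
  have hcard : Fintype.card (ResState N (2 ^ (2 * r + 4)))
      = Fintype.card (Mem ((N + 1) * (2 * r + 4))) := by
    simp [← pow_mul, ← pow_add]
    ring
  refine ⟨residueAlg (Fintype.equivOfCardEq hcard) P,
    residueAlg_solves _ hP (fun ρ => (h ρ).1) (fun ρ => (h ρ).2.trans_lt ?_) hr,
    -- The modulus is part of the state, so only the initialization looks at the seed.
    fun _ _ => ⟨rfl, rfl⟩⟩
  exact Nat.pow_lt_pow_right (by norm_num) (by omega)

theorem exists_classicalAlg_logb (N F : ℕ) :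
    ∃ (s : ℕ) (A : ClassicalAlg N s), A.Solves F ∧ A.StoresCoins ∧ (2 ≤ N → 2 ≤ F →
      (s : ℝ) ≤ 24 * (N * (Real.logb 2 (Real.logb 2 F) + Real.logb 2 N))) := by
  set r := Nat.clog 2 (3 * (N * Nat.log 2 F)) with hr
  obtain ⟨A, hA, hA'⟩ := exists_classicalAlg N F r (Nat.le_pow_clog (by norm_num) _)
  refine ⟨_, A, hA, hA', fun hN hF => ?_⟩
  have hL : 1 ≤ Nat.log 2 F := Nat.log_pos (by norm_num) hF
  have hNR : (2 : ℝ) ≤ N := by exact_mod_cast hN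
  have hLR : (1 : ℝ) ≤ Nat.log 2 F := by exact_mod_cast hL
  have hlog : (Nat.log 2 F : ℝ) ≤ Real.logb 2 F := by
    simpa using Real.natLog_le_logb F 2
  have hlogN : 1 ≤ Real.logb 2 N := by
    rw [Real.le_logb_iff_rpow_le (by norm_num) (by positivity)]; simpa using hNR
  have hll : 0 ≤ Real.logb 2 (Real.logb 2 F) :=
    Real.logb_nonneg (by norm_num) (hLR.trans hlog)
  have hr1 : (r : ℝ) ≤ 3 + Real.logb 2 N + Real.logb 2 (Real.logb 2 F) := by
    have hprod : 1 < 3 * (N * Nat.log 2 F) := by nlinarith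
    have h1 : 2 ^ (r - 1) < 3 * (N * Nat.log 2 F) := by
      have := Nat.pow_pred_clog_lt_self (b := 2) (by norm_num) hprod
      simpa [hr] using this
    have hrpos : 0 < r := Nat.clog_pos (by norm_num) hprod
    have h2 : 2 ^ r ≤ 8 * (N * Nat.log 2 F) := by
      have : 2 ^ r = 2 ^ (r - 1) * 2 := by rw [← pow_succ]; congr 1; omega
      omega
    have h3 : (2 : ℝ) ^ (r : ℝ) ≤ 2 ^ (3 : ℝ) * (N * Real.logb 2 F) := by
      rw [Real.rpow_natCast]
      calc (2 : ℝ) ^ r ≤ 8 * (N * Nat.log 2 F) := by exact_mod_cast h2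
        _ ≤ 8 * (N * Real.logb 2 F) := by gcongr
        _ = _ := by norm_num
    rw [← Real.le_logb_iff_rpow_le (by norm_num) (by have := hLR.trans hlog; positivity),
      Real.logb_mul (by positivity) (by have := hLR.trans hlog; positivity),
      Real.logb_mul (by positivity) (by have := hLR.trans hlog; positivity),
      Real.logb_rpow (by norm_num) (by norm_num)] at h3
    linarith
  push_cast
  nlinarith [mul_nonneg (by linarith : (0 : ℝ) ≤ N) hll]

/-! ### Amplification by majority -/

/-- Exponential moment bound: weigh a tuple by 2 to the number of its bad entries. The total weight
is at most `(4/3 |Ω|) ^ (2u)`, while each counted tuple weighs at least `2 ^ u`; the ratio per unit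
of `u` is `(16/9) / 2`. -/
theorem card_majority_le {Ω : Type*} [Fintype Ω] (E : Ω → Prop) [DecidablePred E]
    (hE : 3 * (Finset.univ.filter E).card ≤ Fintype.card Ω) (u : ℕ) :
    ((Finset.univ.filter fun ω : Fin (2 * u) → Ω =>
      u ≤ (Finset.univ.filter fun i => E (ω i)).card).card : ℝ)
      ≤ (8 / 9) ^ u * Fintype.card (Fin (2 * u) → Ω) := by
  classical
  have hsum : ∑ ω : Fin (2 * u) → Ω, ∏ i, (if E (ω i) then (2 : ℝ) else 1)
      = (Fintype.card Ω + (Finset.univ.filter E).card) ^ (2 * u) := by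
    have := (Finset.prod_univ_sum (fun _ : Fin (2 * u) => (Finset.univ : Finset Ω))
      (fun _ a => if E a then (2 : ℝ) else 1)).symm
    rw [Fintype.piFinset_univ] at this
    rw [this, Finset.prod_const, Finset.card_univ, Fintype.card_fin]
    congr 1
    have h2 : ∀ a : Ω, (if E a then (2 : ℝ) else 1) = 1 + if E a then 1 else 0 := by
      intro a; split_ifs <;> norm_num
    simp [h2, Finset.sum_add_distrib]
  have hlow : ((Finset.univ.filter fun ω : Fin (2 * u) → Ω =>
      u ≤ (Finset.univ.filter fun i => E (ω i)).card).card : ℝ) * 2 ^ u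
      ≤ ∑ ω : Fin (2 * u) → Ω, ∏ i, (if E (ω i) then (2 : ℝ) else 1) := by
    rw [← nsmul_eq_mul]
    refine (Finset.card_nsmul_le_sum _ _ _ fun ω hω => ?_).trans
      (Finset.sum_le_sum_of_subset_of_nonneg (Finset.subset_univ _) fun ω _ _ => ?_)
    · rw [Finset.prod_ite, Finset.prod_const, Finset.prod_const, one_pow, mul_one]
      exact pow_le_pow_right₀ (by norm_num) (Finset.mem_filter.1 hω).2
    · exact Finset.prod_nonneg fun i _ => by split_ifs <;> norm_num
  have hup : ((Fintype.card Ω : ℝ) + (Finset.univ.filter E).card) ^ (2 * u)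
      ≤ (16 / 9) ^ u * (Fintype.card Ω : ℝ) ^ (2 * u) := by
    have h3 : (3 : ℝ) * (Finset.univ.filter E).card ≤ Fintype.card Ω := by exact_mod_cast hE
    calc ((Fintype.card Ω : ℝ) + (Finset.univ.filter E).card) ^ (2 * u)
        ≤ (4 / 3 * Fintype.card Ω) ^ (2 * u) := by gcongr; linarith
      _ = (16 / 9) ^ u * (Fintype.card Ω : ℝ) ^ (2 * u) := by
        rw [mul_pow, pow_mul (4 / 3 : ℝ)]; norm_num
  have hkey := hlow.trans (hsum.le.trans hup)
  have h16 : (16 / 9 : ℝ) ^ u = (8 / 9) ^ u * 2 ^ u := by rw [← mul_pow]; norm_num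
  rw [h16] at hkey
  have hcard : (Fintype.card (Fin (2 * u) → Ω) : ℝ) = (Fintype.card Ω : ℝ) ^ (2 * u) := by simp
  rw [hcard]
  refine le_of_mul_le_mul_right ?_ (by positivity : (0 : ℝ) < 2 ^ u)
  linarith

theorem eight_ninths_pow_le (n : ℕ) : (8 / 9 : ℝ) ^ (6 * n) ≤ (1 / 2) ^ n := by
  rw [pow_mul]
  exact pow_le_pow_left₀ (by positivity) (by norm_num) n

/-! ### Random access codes -/

/-- The generating function of Hamming distance factors over coordinates: one agreeing letter of
weight 1, all others of weight `l`. -/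
theorem sum_pow_card_ne {ι α : Type*} [Fintype ι] [DecidableEq ι] [Fintype α] [DecidableEq α]
    (l : ℝ) (y : ι → α) :
    ∑ x : ι → α, l ^ (Finset.univ.filter fun j => y j ≠ x j).card
      = (1 + l * (Fintype.card α - 1)) ^ Fintype.card ι := by
  have h1 : ∀ x : ι → α, l ^ (Finset.univ.filter fun j => y j ≠ x j).card
      = ∏ j, if y j ≠ x j then l else 1 := by
    intro x
    rw [Finset.prod_ite, Finset.prod_const, Finset.prod_const, one_pow, mul_one]
  simp_rw [h1]
  have := (Finset.prod_univ_sum (fun _ : ι => (Finset.univ : Finset α))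
    (fun j a => if y j ≠ a then l else 1)).symm
  rw [Fintype.piFinset_univ] at this
  rw [this, ← Finset.card_univ (α := ι), ← Finset.prod_const]
  refine Finset.prod_congr rfl fun j _ => ?_
  have h2 : ∀ a : α, (if y j ≠ a then l else 1) = l + if y j = a then 1 - l else 0 := by
    intro a; split_ifs <;> simp_all
  simp only [h2, Finset.sum_add_distrib, Finset.sum_const, Finset.card_univ, nsmul_eq_mul,
    Finset.sum_ite_eq, Finset.mem_univ, if_true]
  ring

/-- Jensen's inequality for `t ↦ l ^ t`, through its tangent line at `a`; the slope is nonpositive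
because `l ≤ 1`, so an upper bound on the mean suffices. -/
theorem card_mul_rpow_le_sum {Ω : Type*} [Fintype Ω] (d : Ω → ℕ) {l a : ℝ} (hl : 0 < l)
    (hl1 : l ≤ 1) (hd : ∑ ω, (d ω : ℝ) ≤ a * Fintype.card Ω) :
    Fintype.card Ω * l ^ a ≤ ∑ ω, l ^ d ω := by
  have hlog : Real.log l ≤ 0 := Real.log_nonpos hl.le hl1
  have hpt : ∀ ω, l ^ a * (1 + (d ω - a) * Real.log l) ≤ l ^ d ω := by
    intro ω
    have h1 : (l : ℝ) ^ d ω = l ^ a * Real.exp ((d ω - a) * Real.log l) := by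
      rw [← Real.rpow_natCast, Real.rpow_def_of_pos hl, Real.rpow_def_of_pos hl, ← Real.exp_add]
      ring_nf
    rw [h1]
    have := Real.add_one_le_exp ((d ω - a) * Real.log l)
    have hpos : 0 < l ^ a := Real.rpow_pos_of_pos hl a
    gcongr
    linarith
  refine le_trans ?_ (Finset.sum_le_sum fun ω _ => hpt ω)
  rw [← Finset.mul_sum, Finset.sum_add_distrib, ← Finset.sum_mul, Finset.sum_sub_distrib]
  simp only [Finset.sum_const, Finset.card_univ, nsmul_eq_mul, mul_one]
  have hpos : 0 < l ^ a := Real.rpow_pos_of_pos hl a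
  have : 0 ≤ (∑ ω, (d ω : ℝ) - Fintype.card Ω * a) * Real.log l :=
    mul_nonneg_of_nonpos_of_nonpos (by linarith) hlog
  nlinarith

/-- Sum `l ^ (Hamming distance from x to its decoding)` over all `ω` and `x`. For fixed `x` the mean
distance is at most `ε n`, with `n` the word length, and Jensen bounds the sum below. For fixed `ω`,
replacing the actual memory by a sum over all memories bounds it above. -/
theorem card_pow_mul_rpow_le_of_code {Ω M ι α : Type*} [Fintype Ω] [Nonempty Ω] [Fintype M]
    [Fintype ι] [Fintype α] [DecidableEq α] (enc : Ω → (ι → α) → M) (dec : Ω → M → ι → α) {ε l : ℝ}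
    (hl : 0 < l) (hl1 : l ≤ 1)
    (h : ∀ x j, ((Finset.univ.filter fun ω => dec ω (enc ω x) j ≠ x j).card : ℝ)
      ≤ ε * Fintype.card Ω) :
    (Fintype.card α : ℝ) ^ Fintype.card ι * l ^ (ε * Fintype.card ι)
      ≤ Fintype.card M * (1 + l * (Fintype.card α - 1)) ^ Fintype.card ι := by
  classical
  let d : Ω → (ι → α) → ℕ := fun ω x =>
    (Finset.univ.filter fun j => dec ω (enc ω x) j ≠ x j).card
  have hlow : ∀ x, Fintype.card Ω * l ^ (ε * Fintype.card ι) ≤ ∑ ω, l ^ d ω x := by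
    intro x
    refine card_mul_rpow_le_sum _ hl hl1 ?_
    have hswap : ∑ ω, (d ω x : ℝ)
        = ∑ j, ((Finset.univ.filter fun ω => dec ω (enc ω x) j ≠ x j).card : ℝ) := by
      simp only [d, Finset.card_filter, Nat.cast_sum]
      exact Finset.sum_comm
    rw [hswap]
    refine (Finset.sum_le_sum fun j _ => h x j).trans (le_of_eq ?_)
    simp only [Finset.sum_const, Finset.card_univ, nsmul_eq_mul]
    ring
  have hup : ∀ ω, ∑ x, l ^ d ω x
      ≤ Fintype.card M * (1 + l * (Fintype.card α - 1)) ^ Fintype.card ι := by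
    intro ω
    calc ∑ x, l ^ d ω x
        ≤ ∑ x : ι → α, ∑ m : M, l ^ (Finset.univ.filter fun j => dec ω m j ≠ x j).card :=
          Finset.sum_le_sum fun x _ => Finset.single_le_sum
            (f := fun m => l ^ (Finset.univ.filter fun j => dec ω m j ≠ x j).card)
            (fun m _ => by positivity) (Finset.mem_univ (enc ω x))
      _ = ∑ m : M, ∑ x : ι → α, l ^ (Finset.univ.filter fun j => dec ω m j ≠ x j).card :=
          Finset.sum_comm
      _ = _ := by simp [sum_pow_card_ne]
  have h1 := Finset.sum_le_sum (s := Finset.univ) fun x _ => hlow x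
  have h2 := Finset.sum_le_sum (s := Finset.univ) fun ω _ => hup ω
  rw [Finset.sum_comm] at h1
  have h3 := h1.trans h2
  simp only [Finset.sum_const, Finset.card_univ, nsmul_eq_mul, Fintype.card_fun,
    Nat.cast_pow] at h3
  have hΩ : (0 : ℝ) < Fintype.card Ω := by exact_mod_cast Fintype.card_pos
  refine le_of_mul_le_mul_left ?_ hΩ
  linarith

theorem mul_logb_le_of_code {Ω : Type*} [Fintype Ω] [Nonempty Ω] {b n F : ℕ} (hF : 2 ≤ F)
    {M : Type*} [Fintype M] (hM : Fintype.card M = 2 ^ b)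
    (enc : Ω → (Fin n → Fin F) → M) (dec : Ω → M → Fin n → Fin F)
    (h : ∀ x j, ((Finset.univ.filter fun ω => dec ω (enc ω x) j ≠ x j).card : ℝ)
      ≤ 1 / 16 * Fintype.card Ω) :
    n * Real.logb 2 F ≤ 4 * b := by
  have hFR : (2 : ℝ) ≤ F := by exact_mod_cast hF
  -- Weight `1 / (4F)` keeps the generating function below `5/4` per letter, while the error rate
  -- `1/16` costs only a factor `(4F) ^ (1/16)` per letter.
  have hl : (0 : ℝ) < 1 / (4 * F) := by positivity
  have hl1 : 1 / (4 * F : ℝ) ≤ 1 := by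
    rw [div_le_one (by positivity)]; linarith
  have hkey := card_pow_mul_rpow_le_of_code enc dec hl hl1 h
  rw [hM] at hkey
  simp only [Fintype.card_fin] at hkey
  have hbase : 1 + 1 / (4 * F : ℝ) * (F - 1) ≤ 5 / 4 := by
    have : 1 / (4 * F : ℝ) * (F - 1) = 1 / 4 - 1 / (4 * F) := by field_simp
    linarith
  have hkey2 : (F : ℝ) ^ n * (1 / (4 * F : ℝ)) ^ (1 / 16 * n : ℝ) ≤ 2 ^ b * (5 / 4) ^ n := by
    refine hkey.trans ?_
    push_cast
    have : (0 : ℝ) ≤ 1 + 1 / (4 * F : ℝ) * (F - 1) := by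
      have : (0 : ℝ) ≤ F - 1 := by linarith
      positivity
    gcongr
  have h2 := Real.logb_le_logb_of_le (b := 2) (by norm_num) (by positivity) hkey2
  have hF0 : (F : ℝ) ≠ 0 := by positivity
  rw [Real.logb_mul (by positivity) (by positivity), Real.logb_mul (by positivity) (by positivity),
    Real.logb_pow, Real.logb_pow, Real.logb_pow, Real.logb_rpow_eq_mul_logb_of_pos hl,
    one_div (4 * F : ℝ), Real.logb_inv, Real.logb_mul (by norm_num) hF0, Real.logb_self_eq_one (by norm_num)] at h2
  have h4 : Real.logb 2 4 = 2 := by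
    rw [show (4 : ℝ) = 2 ^ (2 : ℝ) by norm_num, Real.logb_rpow (by norm_num) (by norm_num)]
  have h54 : Real.logb 2 (5 / 4) ≤ 1 / 2 := by
    have : Real.logb 2 ((5 / 4) ^ 2) ≤ Real.logb 2 2 :=
      Real.logb_le_logb_of_le (by norm_num) (by norm_num) (by norm_num)
    rw [Real.logb_pow, Real.logb_self_eq_one (by norm_num)] at this
    push_cast at this
    linarith
  have hlF : 1 ≤ Real.logb 2 F := by
    rw [Real.le_logb_iff_rpow_le (by norm_num) (by positivity)]; simpa using hFR
  rw [h4] at h2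
  have hn : (0 : ℝ) ≤ n := by positivity
  nlinarith [mul_nonneg hn (sub_nonneg.2 hlF), mul_nonneg hn (sub_nonneg.2 h54)]

/-! ### Streams encoding strings -/

/-- The stream that gives element `j` frequency `x j + 1`. -/
def wordStream {N F : ℕ} (x : Fin N → Fin F) : TStream N :=
  List.ofFn fun j => (j, ((x j : ℕ) : ℤ) + 1)

/-- The update that takes the frequency `y + 1` away from `j`. -/
def queryUpdate {N F : ℕ} (j : Fin N) (y : Fin F) : Fin N × ℤ := (j, -(((y : ℕ) : ℤ) + 1))

theorem freq_wordStream {N F : ℕ} (x : Fin N → Fin F) (i : Fin N) :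
    freq (wordStream x) i = ((x i : ℕ) : ℤ) + 1 := by
  have h : ∀ σ : TStream N, freq σ i = (σ.map fun u => if u.1 = i then u.2 else 0).sum := by
    intro σ
    induction σ with
    | nil => rfl
    | cons u σ ih =>
      rw [List.map_cons, List.sum_cons, ← ih, ← List.singleton_append, freq_append,
        show [u] = [(u.1, u.2)] from rfl, freq_singleton]
  rw [h, wordStream, List.map_ofFn, List.sum_ofFn]
  simp

theorem freq_wordStream_query {N F : ℕ} (x : Fin N → Fin F) (j : Fin N) (y : Fin F) (i : Fin N) :
    freq (wordStream x ++ [queryUpdate j y]) i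
      = ((x i : ℕ) : ℤ) + 1 - if j = i then ((y : ℕ) : ℤ) + 1 else 0 := by
  rw [freq_append, freq_wordStream, queryUpdate, freq_singleton]
  split_ifs <;> ring

theorem promise_wordStream_query {N F : ℕ} (x : Fin N → Fin F) (j : Fin N) (y : Fin F) :
    Promise F (wordStream x ++ [queryUpdate j y]) := by
  intro i
  rw [freq_wordStream_query, abs_le]
  have := (x i).2
  have := y.2
  split_ifs <;> omega

/-- The shift by one keeps untouched frequencies positive, so only the queried element can vanish.
-/
theorem distinctItems_wordStream_query {N F : ℕ} (x : Fin N → Fin F) (j : Fin N) (y : Fin F) :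
    distinctItems (wordStream x ++ [queryUpdate j y]) = if x j = y then N - 1 else N := by
  rw [distinctItems]
  simp_rw [freq_wordStream_query]
  split_ifs with h
  · have : (Finset.univ.filter fun i : Fin N =>
        ((x i : ℕ) : ℤ) + 1 - (if j = i then ((y : ℕ) : ℤ) + 1 else 0) ≠ 0)
        = Finset.univ.erase j := by
      ext i
      simp only [Finset.mem_filter, Finset.mem_univ, true_and, Finset.mem_erase, and_true]
      by_cases hij : j = i
      · subst hij; simp [h]
      · simp only [hij, if_false, ne_eq, Ne.symm hij, not_false_eq_true, iff_true]; omega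
    rw [this, Finset.card_erase_of_mem (Finset.mem_univ j)]
    simp
  · rw [Finset.filter_true_of_mem, Finset.card_univ, Fintype.card_fin]
    intro i _
    by_cases hij : j = i
    · subst hij
      have : (x j : ℕ) ≠ y := fun h' => h (Fin.ext h')
      simp only [if_true]
      omega
    · simp only [hij, if_false]; omega

/-! ### Bit strings of bounded length -/

/-- The bit strings of length at most `h`. -/
def shortStrings (h : ℕ) : Finset (List Bool) :=
  (Finset.range (h + 1)).biUnion fun n =>
    Finset.univ.image fun f : Fin n → Bool => List.ofFn f

theorem mem_shortStrings {h : ℕ} {w : List Bool} (hw : w.length ≤ h) : w ∈ shortStrings h := by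
  simp only [shortStrings, Finset.mem_biUnion, Finset.mem_range, Finset.mem_image,
    Finset.mem_univ, true_and]
  exact ⟨w.length, by omega, w.get, List.ofFn_get w⟩

theorem card_shortStrings_le (h : ℕ) : (shortStrings h).card ≤ 2 ^ (h + 1) := by
  calc (shortStrings h).card ≤ ∑ n ∈ Finset.range (h + 1), 2 ^ n := by
        refine Finset.card_biUnion_le.trans (Finset.sum_le_sum fun n _ => ?_)
        exact Finset.card_image_le.trans (by simp)
    _ ≤ 2 ^ (h + 1) := by
        have := Nat.geomSum_eq (le_refl 2) (h + 1)
        rw [this]; simp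

/-! ### From a scheme to a code -/

section Code

variable {N v F : ℕ} (S : Scheme N v)

/-- The outcome of the verifier, from the summary `m` of a word, for the query `(j, y)` and the
proof `w`. -/
def Scheme.answer (ρ : Coins S.r) (m : Mem v) (j : Fin N) (y : Fin F) (w : List Bool) :
    Option ℕ :=
  S.out ρ (w.foldl (S.read ρ) (S.update ρ m (queryUpdate j y)))

theorem Scheme.answer_summary (ρ : Coins S.r) (x : Fin N → Fin F) (j : Fin N) (y : Fin F)
    (w : List Bool) :
    S.answer ρ (S.summary ρ (wordStream x)) j y w
      = S.output ρ (wordStream x ++ [queryUpdate j y]) w := by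
  simp [Scheme.answer, Scheme.output, StreamProc.summary]

/-- Some proof of length at most `h` makes a majority of the copies of the verifier declare
that the letter at `j` is `y`. -/
def Scheme.Accepts (h u : ℕ) (ω : Fin (2 * u) → Coins S.r) (m : Fin (2 * u) → Mem v) (j : Fin N)
    (y : Fin F) : Prop :=
  ∃ w ∈ shortStrings h,
    (Finset.univ.filter fun i => S.answer (ω i) (m i) j y w ≠ some (N - 1)).card < u

open Classical in
/-- The letter found by trying all letters and all proofs. -/
noncomputable def Scheme.decode [Inhabited (Fin F)] (h u : ℕ) (ω : Fin (2 * u) → Coins S.r)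
    (m : Fin (2 * u) → Mem v) (j : Fin N) : Fin F :=
  if hy : ∃ y, S.Accepts h u ω m j y then hy.choose else default

/-- The summaries of a word by independent copies of the verifier. -/
def Scheme.encode (u : ℕ) (ω : Fin (2 * u) → Coins S.r) (x : Fin N → Fin F) :
    Fin (2 * u) → Mem v :=
  fun i => S.summary (ω i) (wordStream x)

theorem card_le_of_coinProb_le {r : ℕ} {E : Coins r → Prop} [DecidablePred E]
    (h : coinProb E ≤ 1 / 3) :
    3 * (Finset.univ.filter E).card ≤ Fintype.card (Coins r) := by
  rw [coinProb_eq, div_le_div_iff₀ (by positivity) (by norm_num), one_mul] at h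
  have : (Finset.univ.filter E).card * 3 ≤ 2 ^ r := by exact_mod_cast h
  simp only [Fintype.card_pi, Fintype.card_bool, Finset.prod_const, Finset.card_univ,
    Fintype.card_fin]
  omega

-- Decoding errs only if the true letter fails with the honest proof (completeness) or a wrong
-- letter passes with some short proof (soundness). Proofs do not depend on the coins, so each of
-- these `1 + F * 2 ^ (h + 1)` events is a majority failure at a fixed proof.
open Classical in
theorem Scheme.card_decode_ne_le [Inhabited (Fin F)] {h : ℕ} (hS : S.Solves F)
    (hlen : ∀ σ : TStream N, Promise F σ → (S.help σ).length ≤ h) (u : ℕ) (x : Fin N → Fin F)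
    (j : Fin N) :
    ((Finset.univ.filter fun ω : Fin (2 * u) → Coins S.r =>
      S.decode h u ω (S.encode u ω x) j ≠ x j).card : ℝ)
      ≤ (1 + F * 2 ^ (h + 1)) * ((8 / 9) ^ u * Fintype.card (Fin (2 * u) → Coins S.r)) := by
  set w₀ := S.help (wordStream x ++ [queryUpdate j (x j)]) with hw₀
  set B := (8 / 9 : ℝ) ^ u * Fintype.card (Fin (2 * u) → Coins S.r) with hB
  let bad₀ : Finset (Fin (2 * u) → Coins S.r) := Finset.univ.filter fun ω => u ≤
    (Finset.univ.filter fun i =>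
      S.answer (ω i) (S.summary (ω i) (wordStream x)) j (x j) w₀ ≠ some (N - 1)).card
  let bad : Fin F → List Bool → Finset (Fin (2 * u) → Coins S.r) := fun y w =>
    Finset.univ.filter fun ω => u ≤ (Finset.univ.filter fun i =>
      S.answer (ω i) (S.summary (ω i) (wordStream x)) j y w = some (N - 1)).card
  have hbad₀ : (bad₀.card : ℝ) ≤ B := by
    refine card_majority_le
      (fun ρ => S.answer ρ (S.summary ρ (wordStream x)) j (x j) w₀ ≠ some (N - 1))
      (card_le_of_coinProb_le ?_) u
    have := hS.1 _ (promise_wordStream_query x j (x j))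
    simpa only [distinctItems_wordStream_query, if_true, S.answer_summary] using this
  have hbad : ∀ y w, y ≠ x j → ((bad y w).card : ℝ) ≤ B := by
    intro y w hy
    refine card_majority_le
      (fun ρ => S.answer ρ (S.summary ρ (wordStream x)) j y w = some (N - 1))
      ?_ u
    have h1 := card_le_of_coinProb_le (hS.2 _ (promise_wordStream_query x j y) w)
    refine le_trans (Nat.mul_le_mul_left 3 (Finset.card_le_card fun ρ hρ => ?_)) h1
    simp only [Finset.mem_filter, Finset.mem_univ, true_and, S.answer_summary] at hρ ⊢
    rw [distinctItems_wordStream_query, if_neg (Ne.symm hy), hρ]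
    -- Since `j` exists, `N` is positive, and `N - 1` differs from the true answer `N` despite
    -- truncated subtraction.
    have := j.2
    simp only [ne_eq, Option.some.injEq, reduceCtorEq, not_false_eq_true, and_true]
    omega
  have hsub : (Finset.univ.filter fun ω : Fin (2 * u) → Coins S.r =>
      S.decode h u ω (S.encode u ω x) j ≠ x j)
      ⊆ bad₀ ∪ ((Finset.univ.erase (x j)) ×ˢ shortStrings h).biUnion fun q => bad q.1 q.2 := by
    intro ω hω
    have hne := (Finset.mem_filter.1 hω).2
    by_cases hacc : S.Accepts h u ω (S.encode u ω x) j (x j)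
    · have hex : ∃ y, S.Accepts h u ω (S.encode u ω x) j y := ⟨_, hacc⟩
      rw [Scheme.decode, dif_pos hex] at hne
      obtain ⟨w, hw, hlt⟩ := hex.choose_spec
      refine Finset.mem_union_right _ (Finset.mem_biUnion.2 ⟨(hex.choose, w), ?_, ?_⟩)
      · exact Finset.mem_product.2 ⟨Finset.mem_erase.2 ⟨hne, Finset.mem_univ _⟩, hw⟩
      · refine Finset.mem_filter.2 ⟨Finset.mem_univ _, ?_⟩
        -- Fewer than `u` of the `2 * u` copies dissent, so more than `u` are fooled.
        have htot : (Finset.univ.filter fun i => S.answer (ω i) (S.summary (ω i) (wordStream x)) j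
              hex.choose w = some (N - 1)).card + (Finset.univ.filter fun i =>
              S.answer (ω i) (S.encode u ω x i) j hex.choose w ≠ some (N - 1)).card = 2 * u := by
          refine Eq.trans ?_ ((Finset.card_univ (α := Fin (2 * u))).trans (Fintype.card_fin _))
          convert Finset.card_filter_add_card_filter_not
            (s := (Finset.univ : Finset (Fin (2 * u)))) (fun i => S.answer (ω i)
              (S.summary (ω i) (wordStream x)) j hex.choose w = some (N - 1)) using 2
          simp only [Scheme.encode, ne_eq]
          congr!
        dsimp only
        omega
    · refine Finset.mem_union_left _ (Finset.mem_filter.2 ⟨Finset.mem_univ _, ?_⟩)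
      by_contra hlt
      exact hacc ⟨w₀, mem_shortStrings (hlen _ (promise_wordStream_query x j (x j))),
        not_le.1 hlt⟩
  have hB0 : 0 ≤ B := by positivity
  calc _ ≤ ((bad₀ ∪ ((Finset.univ.erase (x j)) ×ˢ shortStrings h).biUnion
          fun q => bad q.1 q.2).card : ℝ) := by exact_mod_cast Finset.card_le_card hsub
    _ ≤ (bad₀.card : ℝ) + ∑ q ∈ (Finset.univ.erase (x j)) ×ˢ shortStrings h,
          ((bad q.1 q.2).card : ℝ) := by
        exact_mod_cast (Finset.card_union_le _ _).trans
          (Nat.add_le_add_left Finset.card_biUnion_le _)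
    _ ≤ B + ((Finset.univ.erase (x j)) ×ˢ shortStrings h).card * B := by
        refine add_le_add hbad₀ ?_
        rw [← nsmul_eq_mul]
        refine Finset.sum_le_card_nsmul _ _ _ fun q hq => hbad _ _ ?_
        exact Finset.ne_of_mem_erase (Finset.mem_product.1 hq).1
    _ ≤ B + (F * 2 ^ (h + 1)) * B := by
        gcongr
        have : ((Finset.univ.erase (x j)) ×ˢ shortStrings h).card ≤ F * 2 ^ (h + 1) := by
          rw [Finset.card_product]
          exact Nat.mul_le_mul ((Finset.card_le_univ _).trans (by simp)) (card_shortStrings_le h)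
        exact_mod_cast this
    _ = _ := by ring

end Code

theorem HasScheme.lower_bound {N F h v : ℕ} (hF : 2 ≤ F) (hs : HasScheme N F h v) :
    1 / 384 * (N * Real.logb 2 F) ≤ (h + Real.logb 2 F) * v := by
  classical
  obtain ⟨S, hS, hlen⟩ := hs
  have : Inhabited (Fin F) := ⟨⟨0, by omega⟩⟩
  set k := Nat.log 2 F + 1 with hk
  -- Six copies gain a factor `1/2`, so the error is at most `2 ^ (h + k + 2) * 2 ^ (-(h + k + 6)) =
  -- 1/16`.
  set u := 6 * (h + k + 6) with hu
  have hFR : (2 : ℝ) ≤ F := by exact_mod_cast hF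
  have hFk : F ≤ 2 ^ k := (Nat.lt_pow_succ_log_self (by norm_num) F).le
  have hcode := mul_logb_le_of_code (b := v * (2 * u)) (n := N) hF
    (M := Fin (2 * u) → Mem v) (by simp [pow_mul]) (fun ω => S.encode u ω)
    (fun ω m j => S.decode h u ω m j) fun x j => by
      refine le_trans (by convert S.card_decode_ne_le hS hlen u x j) ?_
      rw [← mul_assoc]
      gcongr
      calc (1 + (F : ℝ) * 2 ^ (h + 1)) * (8 / 9) ^ u
          ≤ (2 ^ (h + k + 1) + 2 ^ k * 2 ^ (h + 1)) * (1 / 2) ^ (h + k + 6) := by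
            have h1 : (1 : ℝ) ≤ 2 ^ (h + k + 1) := one_le_pow₀ (by norm_num)
            have h2 : (F : ℝ) ≤ 2 ^ k := by exact_mod_cast hFk
            have h3 := eight_ninths_pow_le (h + k + 6)
            gcongr
        _ = 1 / 16 := by
            have : ∀ n : ℕ, (2 : ℝ) ^ n * (1 / 2) ^ n = 1 := fun n => by
              rw [← mul_pow]; norm_num
            have e := this (h + k)
            calc _ = (2 ^ (h + k) * (1 / 2 : ℝ) ^ (h + k)) * (1 / 16) := by ring
              _ = _ := by rw [e, one_mul]
  have hlog : (Nat.log 2 F : ℝ) ≤ Real.logb 2 F := by simpa using Real.natLog_le_logb F 2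
  have hlF : 1 ≤ Real.logb 2 F := by
    rw [Real.le_logb_iff_rpow_le (by norm_num) (by positivity)]; simpa using hFR
  have hu' : (2 * u : ℝ) ≤ 96 * (h + Real.logb 2 F) := by
    rw [hu, hk]
    push_cast
    have : (0 : ℝ) ≤ h := by positivity
    linarith
  have hv : (0 : ℝ) ≤ v := by positivity
  push_cast at hcode
  nlinarith [mul_le_mul_of_nonneg_left hu' hv]

/-! ### Frequency bounds of the form `exp (N ^ polylog N)` -/

theorem one_le_logb_two_natCast {N : ℕ} (hN : 2 ≤ N) : 1 ≤ Real.logb 2 N := by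
  have hNR : (2 : ℝ) ≤ N := by exact_mod_cast hN
  rw [Real.le_logb_iff_rpow_le (by norm_num) (by positivity)]
  simpa using hNR

theorem one_le_powPolylog (c : ℕ) {N : ℕ} (hN : 2 ≤ N) : 1 ≤ powPolylog c N :=
  Real.one_le_rpow (by exact_mod_cast (by omega : 1 ≤ N))
    (pow_nonneg (zero_le_one.trans (one_le_logb_two_natCast hN)) c)

theorem logb_freqBound (c N : ℕ) : Real.logb 2 (freqBound c N) = ⌈powPolylog c N⌉₊ := by
  rw [freqBound, Nat.cast_pow, Real.logb_pow, Nat.cast_ofNat,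
    Real.logb_self_eq_one (by norm_num), mul_one]

theorem two_le_freqBound (c : ℕ) {N : ℕ} (hN : 2 ≤ N) : 2 ≤ freqBound c N := by
  have h : ⌈powPolylog c N⌉₊ ≠ 0 :=
    (Nat.ceil_pos.2 (zero_lt_one.trans_le (one_le_powPolylog c hN))).ne'
  simpa [freqBound] using Nat.pow_le_pow_right (n := 2) (by norm_num) (Nat.one_le_iff_ne_zero.2 h)

theorem logb_logb_freqBound_le (c : ℕ) {N : ℕ} (hN : 2 ≤ N) :
    Real.logb 2 (Real.logb 2 (freqBound c N)) ≤ 1 + Real.logb 2 N ^ (c + 1) := by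
  have hX := one_le_powPolylog c hN
  have hN0 : (0 : ℝ) < N := by exact_mod_cast (by omega : 0 < N)
  have hceil : (⌈powPolylog c N⌉₊ : ℝ) ≤ 2 * powPolylog c N := by
    have := (Nat.ceil_lt_add_one (zero_le_one.trans hX)).le
    linarith
  have hpos : (0 : ℝ) < ⌈powPolylog c N⌉₊ :=
    zero_lt_one.trans_le (hX.trans (Nat.le_ceil _))
  rw [logb_freqBound]
  calc Real.logb 2 ⌈powPolylog c N⌉₊ ≤ Real.logb 2 (2 * powPolylog c N) :=
        Real.logb_le_logb_of_le (by norm_num) hpos hceil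
    _ = 1 + Real.logb 2 N ^ (c + 1) := by
        rw [Real.logb_mul (by norm_num) (by positivity), Real.logb_self_eq_one (by norm_num),
          powPolylog, Real.logb_rpow_eq_mul_logb_of_pos hN0, pow_succ]

theorem exists_classicalAlg_freqBound (c : ℕ) : ∃ s : ℕ → ℕ,
    (∀ N : ℕ, ∃ A : ClassicalAlg N (s N), A.Solves (freqBound c N) ∧ A.StoresCoins) ∧
    (fun N : ℕ => (s N : ℝ)) =O[atTop] fun N : ℕ => (N : ℝ) * Real.logb 2 N ^ (c + 1) := by
  choose s A hA hA' hs using fun N : ℕ => exists_classicalAlg_logb N (freqBound c N)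
  refine ⟨s, fun N => ⟨A N, hA N, hA' N⟩, IsBigO.of_bound 72 ?_⟩
  filter_upwards [eventually_ge_atTop 2] with N hN
  have hl := one_le_logb_two_natCast hN
  have h1 : 1 ≤ Real.logb 2 N ^ (c + 1) := one_le_pow₀ hl
  have h2 : Real.logb 2 N ≤ Real.logb 2 N ^ (c + 1) := le_self_pow₀ hl (by omega)
  have hN0 : (0 : ℝ) ≤ N := by positivity
  rw [Real.norm_of_nonneg (by positivity), Real.norm_of_nonneg (by positivity)]
  calc (s N : ℝ)
      ≤ 24 * (N * (Real.logb 2 (Real.logb 2 (freqBound c N)) + Real.logb 2 N)) :=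
        hs N hN (two_le_freqBound c hN)
    _ ≤ 24 * (N * (3 * Real.logb 2 N ^ (c + 1))) := by
        have := logb_logb_freqBound_le c hN
        gcongr
        linarith
    _ = _ := by ring

/-- Taking the exponent `c + 1` in non-triviality cancels the polylogarithm in the classical upper
bound. -/
theorem Nontrivial.isLittleO_natCast {c : ℕ} {v : ℕ → ℕ} (hv : Nontrivial (freqBound c) v) :
    (fun N : ℕ => (v N : ℝ)) =o[atTop] fun N : ℕ => (N : ℝ) := by
  obtain ⟨s, hs, hO⟩ := exists_classicalAlg_freqBound c
  have hle : (fun N : ℕ => (streamingComplexity N (freqBound c N) : ℝ))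
      =O[atTop] fun N : ℕ => (s N : ℝ) := by
    refine IsBigO.of_bound 1 (Eventually.of_forall fun N => ?_)
    obtain ⟨A, hA, -⟩ := hs N
    rw [one_mul, Real.norm_of_nonneg (by positivity), Real.norm_of_nonneg (by positivity)]
    exact_mod_cast Nat.sInf_le (⟨A, hA⟩ : ∃ A : ClassicalAlg N (s N), A.Solves (freqBound c N))
  have h := (hv (c + 1)).trans_isBigO (hle.trans hO)
  rw [isLittleO_iff] at h ⊢
  intro ε hε
  filter_upwards [h hε, eventually_ge_atTop 2] with N h hN
  have hl : 0 < Real.logb 2 N ^ (c + 1) :=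
    pow_pos (zero_lt_one.trans_le (one_le_logb_two_natCast hN)) _
  rw [norm_mul, norm_mul, ← mul_assoc] at h
  exact le_of_mul_le_mul_right h (norm_pos_iff.2 hl.ne')

theorem powPolylog_isBigO_totalCost {c : ℕ} {h v : ℕ → ℕ}
    (hs : ∀ᶠ N in atTop, HasScheme N (freqBound c N) (h N) (v N))
    (hv : Nontrivial (freqBound c) v) :
    (fun N : ℕ => powPolylog c N) =O[atTop] fun N : ℕ => ((h N + v N : ℕ) : ℝ) := by
  refine IsBigO.of_bound 1 ?_
  -- With `v` at most half of `N / 384`, the tradeoff gives `h + log₂ F ≥ 2 log₂ F`.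
  have hlit := isLittleO_iff.1 hv.isLittleO_natCast (by norm_num : (0 : ℝ) < 1 / 768)
  filter_upwards [hs, hlit, eventually_ge_atTop 2] with N hsN hvN hN
  have hlow := hsN.lower_bound (two_le_freqBound c hN)
  have hX := one_le_powPolylog c hN
  rw [Real.norm_of_nonneg (by positivity), Real.norm_of_nonneg (by positivity)] at hvN
  rw [logb_freqBound] at hlow
  have hceil := Nat.le_ceil (powPolylog c N)
  have hN0 : (0 : ℝ) < N := by exact_mod_cast (by omega : 0 < N)
  have hle : (⌈powPolylog c N⌉₊ : ℝ) ≤ h N := by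
    have h1 : 1 / 384 * (N * (⌈powPolylog c N⌉₊ : ℝ))
        ≤ (h N + ⌈powPolylog c N⌉₊) * (1 / 768 * N) :=
      hlow.trans (mul_le_mul_of_nonneg_left hvN (by positivity))
    refine le_of_mul_le_mul_left ?_ hN0
    linarith
  rw [one_mul, Real.norm_of_nonneg (by linarith), Real.norm_of_nonneg (by positivity)]
  push_cast
  have : (0 : ℝ) ≤ v N := by positivity
  linarith

end DistItem

theorem theorem6 :
    -- classical streaming, every frequency bound: `O(N (log log F + log N))` bits
    (∃ C : ℝ, 0 < C ∧ ∀ N F : ℕ, 2 ≤ N → 2 ≤ F →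
      ∃ (s : ℕ) (A : DistItem.ClassicalAlg N s), A.Solves F ∧ A.StoresCoins ∧
        (s : ℝ) ≤ C * (N * (Real.logb 2 (Real.logb 2 F) + Real.logb 2 N))) ∧
    -- annotated streaming, every frequency bound: `(h + log F) v = Ω(N log F)`
    (∃ κ : ℝ, 0 < κ ∧ ∀ N F h v : ℕ, 2 ≤ F → DistItem.HasScheme N F h v →
      κ * (N * Real.logb 2 F) ≤ (h + Real.logb 2 F) * v) ∧
    -- the separation, for frequency bound `exp (N ^ polylog N)`
    (∀ c : ℕ,
      (∃ (k : ℕ) (s : ℕ → ℕ),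
        (∀ N : ℕ, ∃ A : DistItem.ClassicalAlg N (s N),
          A.Solves (DistItem.freqBound c N) ∧ A.StoresCoins) ∧
        (fun N : ℕ => (s N : ℝ)) =O[atTop] fun N : ℕ => (N : ℝ) * Real.logb 2 N ^ k) ∧
      (∀ h v : ℕ → ℕ,
        (∀ᶠ N in atTop, DistItem.HasScheme N (DistItem.freqBound c N) (h N) (v N)) →
        DistItem.Nontrivial (DistItem.freqBound c) v →
        (fun N : ℕ => DistItem.powPolylog c N) =O[atTop]
          fun N : ℕ => ((h N + v N : ℕ) : ℝ))) := by
  refine ⟨⟨24, by norm_num, fun N F hN hF => ?_⟩,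
    ⟨1 / 384, by norm_num, fun N F h v hF hs => hs.lower_bound hF⟩,
    fun c => ⟨⟨c + 1, DistItem.exists_classicalAlg_freqBound c⟩,
      fun h v hs hv => DistItem.powPolylog_isBigO_totalCost hs hv⟩⟩
  obtain ⟨s, A, hA, hA', hs⟩ := DistItem.exists_classicalAlg_logb N F
  exact ⟨s, A, hA, hA', hs hN hF⟩
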